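/- Let $K$ be a field endowed with a rank-one valuation $v$ (nontrivial, with $v(K^*)$ a subgroup of $(\mathbb{R},+)$), let $V$ be its valuation domain, let $E$ be a subset of $V$, and let $$\mathrm{Int}(E,V)=\{f(X)\in K[X]\mid f(E)\subseteq V\}$$ be the ring of integer-valued polynomials on $E$. A sequence $\{x_n\}_{n\ge 0}$ of elements of $V$ is *pseudo-divergent* if $v(x_n-x_m)<v(x_m-x_l)$ for all $n>m>l\ge 0$, and *pseudo-stationary* if its terms are pairwise distinct and $v(x_n-x_m)=v(x_m-x_l)$ for all $n>m>l\ge 0$. The *content* of a finitely generated submodule $N$ of $R^m$ is the ideal of $R$ generated by the coordinates of a system of generators of $N$, and $N$ has *unit content* if its content is $R$. A commutative ring $R$ has the *unit content summand (UCS) property* if, for every $m$, every finitely generated submodule of $R^m$ with unit content contains a rank-one projective submodule which is a direct summand of $R^m$. A commutative ring $R$ is *local-global* if every polynomial $f\in R[X_1,\dots,X_n]$ that takes a unit value on $R_{\mathfrak M}^n$ for each maximal ideal $\mathfrak M$ of $R$ takes a unit value on $R^n$; it is *almost local-global* if $R/I$ is local-global for every nonzero ideal $I$ of $R$. **Theorem.**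 If $E$ contains no pseudo-divergent sequence and no pseudo-stationary sequence, then the ring $\mathrm{Int}(E,V)$ has the UCS property. Moreover, $\mathrm{Int}(E,V)$ is almost local-global. -/

import Mathlib

open scoped Polynomial

/-- For a subset `E` of a domain `D` with quotient field `K`, the ring
`Int(E, D) = {f ∈ K[X] | f(E) ⊆ D}` of integer-valued polynomials on `E` with respect to `D`. -/
def integerValuedPolynomials {D : Type*} (K : Type*) [CommRing D] [Field K] [Algebra D K]
    (E : Set D) : Subring K[X] where
  carrier := {f | ∀ a ∈ E, f.eval (algebraMap D K a) ∈ (algebraMap D K).range}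
  mul_mem' hf hg a ha := by
    rw [Polynomial.eval_mul]
    exact mul_mem (hf a ha) (hg a ha)
  one_mem' a _ := by
    rw [Polynomial.eval_one]
    exact one_mem _
  add_mem' hf hg a ha := by
    rw [Polynomial.eval_add]
    exact add_mem (hf a ha) (hg a ha)
  zero_mem' a _ := by
    rw [Polynomial.eval_zero]
    exact zero_mem _
  neg_mem' hf a ha := by
    rw [Polynomial.eval_neg]
    exact neg_mem (hf a ha)

section Sequences

variable {K Γ₀ : Type*} [Field K] [LinearOrderedCommGroupWithZero Γ₀]

/-- Pseudo-divergent sequences. The valuation `v` is written multiplicatively here, so the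
order is reversed: in additive notation the condition reads
`v (x n - x m) < v (x m - x l)` for all `n > m > l`. -/
def IsPseudoDivergent (v : Valuation K Γ₀) (x : ℕ → K) : Prop :=
  ∀ l m n : ℕ, l < m → m < n → v (x m - x l) < v (x n - x m)

/-- Pseudo-stationary sequences: the terms are distinct (which only excludes the constant
sequences), and `v (x n - x m) = v (x m - x l)` for all `n > m > l`. -/
def IsPseudoStationary (v : Valuation K Γ₀) (x : ℕ → K) : Prop :=
  Function.Injective x ∧ ∀ l m n : ℕ, l < m → m < n → v (x n - x m) = v (x m - x l)

end Sequences

section Content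

variable {R : Type*} [CommRing R]

/-- The content of a matrix: the ideal generated by its coefficients. -/
def matrixContent {m k : ℕ} (A : Matrix (Fin m) (Fin k) R) : Ideal R :=
  Ideal.span {r | ∃ i j, A i j = r}

/-- The content of a submodule `N` of `R ^ m`: the ideal generated by the coordinates of the
elements of `N`. It is the content of the matrix of any finite system of generators of `N`, see
`submoduleContent_span_columns`. -/
def submoduleContent {m : ℕ} (N : Submodule R (Fin m → R)) : Ideal R :=
  Ideal.span {r | ∃ x ∈ N, ∃ i, x i = r}

theorem submoduleContent_span_columns {m k : ℕ} (A : Matrix (Fin m) (Fin k) R) :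
    submoduleContent (Submodule.span R (Set.range A.transpose)) = matrixContent A := by
  apply le_antisymm
  · refine Ideal.span_le.2 ?_
    rintro _ ⟨x, hx, i, rfl⟩
    have h : Submodule.span R (Set.range A.transpose) ≤
        Submodule.comap (LinearMap.proj (R := R) (φ := fun _ : Fin m => R) i) (matrixContent A) := by
      refine Submodule.span_le.2 ?_
      rintro _ ⟨j, rfl⟩
      exact Ideal.subset_span ⟨i, j, rfl⟩
    exact h hx
  · refine Ideal.span_le.2 ?_
    rintro _ ⟨i, j, rfl⟩
    exact Ideal.subset_span ⟨A.transpose j, Submodule.subset_span ⟨j, rfl⟩, i, rfl⟩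

end Content

/-- The unit content summand property: for every `m`, every finitely generated submodule of
`R ^ m` with unit content contains a rank-one projective submodule which is a (direct) summand
of `R ^ m`. -/
def HasUCSProperty (R : Type*) [CommRing R] : Prop :=
  ∀ (m : ℕ) (N : Submodule R (Fin m → R)), N.FG → submoduleContent N = ⊤ →
    ∃ P : Submodule R (Fin m → R), P ≤ N ∧ Module.Projective R P ∧
      (∀ p : PrimeSpectrum R, Module.rankAtStalk P p = 1) ∧
      ∃ Q : Submodule R (Fin m → R), IsCompl P Q

/-- A ring is local-global if every polynomial in several variables over it which takes a unit
value over the localization at each maximal ideal takes a unit value over the ring. -/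
def IsLocalGlobal (R : Type*) [CommRing R] : Prop :=
  ∀ (n : ℕ) (f : MvPolynomial (Fin n) R),
    (∀ (M : Ideal R) [M.IsMaximal],
      ∃ x : Fin n → Localization.AtPrime M, IsUnit (MvPolynomial.aeval x f)) →
    ∃ x : Fin n → R, IsUnit (MvPolynomial.eval x f)

/-- A ring is almost local-global if all its proper factor rings, that is, its quotients by
nonzero ideals, are local-global. -/
def IsAlmostLocalGlobal (R : Type*) [CommRing R] : Prop :=
  ∀ I : Ideal R, I ≠ ⊥ → IsLocalGlobal (R ⧸ I)

/-! A nonzero ideal J of Int(E,V) can be proper for two reasons only: its elements have a common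
root in the algebraic closure of K, or they vanish together at points of E modulo the maximal ideal
of V. `ideal_eq_top_of_no_zero` makes this precise. If J contains no nonzero constant, it stays
proper in the principal ideal ring K[X], whence a common root. If J contains a nonzero constant,
residues on E decide.

The second case rests on the hypothesis on E. It forces every infinite subset of E to contain a
pseudo-convergent sequence (`exists_isPseudoConvergent`), along which the quotient of two values of
a nonzero polynomial eventually has residue 0 or 1 (`IsPseudoConvergent.isSmallOrClose_eval`). So an
integer-valued polynomial has finitely many residues on E, and its valuation attains its maximum.
Finiteness gives indicator functions modulo the maximal ideal (`exists_indicator`); the maximum and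
rank one make a polynomial with zero residues nilpotent modulo any nonzero constant.

Both conclusions then follow by the same two moves. Local solutions are glued by indicators until
their residues on E are right; then they are translated by multiples of a nonzero constant of the
maximal ideal, which keeps residues and avoids finitely many bad roots. For UCS, if the minors of
order two of N vanish, N itself is the summand; otherwise N has room for two independent
translations and contains a unimodular vector. -/

/-! ### Extraction of pseudo-convergent sequences. -/

section UltrametricSubsets

variable {K Γ₀ : Type*} [Field K] [LinearOrderedCommGroupWithZero Γ₀]

/-- Pseudo-convergent sequences, with the common value `γ n` of `v (x p - x n)`, `n < p`. -/
def IsPseudoConvergent (v : Valuation K Γ₀) (x : ℕ → K) (γ : ℕ → Γ₀) : Prop :=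
  StrictAnti γ ∧ ∀ n p : ℕ, n < p → v (x p - x n) = γ n

/-- If a set contains no pseudo-divergent sequence, the distances to a given point of an infinite
subset of it attain a maximum. -/
theorem exists_max_dist_of_no_pseudoDivergent (v : Valuation K Γ₀) (S : Set K)
    (hdiv : ∀ x : ℕ → K, (∀ n, x n ∈ S) → ¬ IsPseudoDivergent v x)
    {a : K} (ha : a ∈ S) : ∃ b ∈ S, ∀ c ∈ S, v (c - a) ≤ v (b - a) := by
  by_contra! hcon
  choose! f hfS hf using hcon
  set x : ℕ → K := fun n => f^[n] a
  have hxs : ∀ n, x (n + 1) = f (x n) := fun n => Function.iterate_succ_apply' f n a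
  have hxS : ∀ n, x n ∈ S := by
    intro n
    induction n with
    | zero => exact ha
    | succ n ih => rw [hxs]; exact hfS _ ih
  have hmono : StrictMono fun n => v (x n - a) := by
    refine strictMono_nat_of_lt_succ fun n => ?_
    rw [hxs]
    exact hf _ (hxS n)
  -- The distances to `a` increase strictly, so the later one dominates.
  have hdist : ∀ m n, m < n → v (x n - x m) = v (x n - a) := by
    intro m n hmn
    have := v.map_sub_eq_of_lt_right (hmono hmn)
    rw [← this, ← v.map_sub_swap]
    congr 1; ring
  refine hdiv x hxS fun l m n hlm hmn => ?_
  rw [hdist _ _ hlm, hdist _ _ hmn]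
  exact hmono hmn

/-- One step of the extraction of a pseudo-convergent sequence. -/
theorem exists_infinite_subset_of_smaller_diameter (v : Valuation K Γ₀) (S : Set K)
    (hdiv : ∀ x : ℕ → K, (∀ n, x n ∈ S) → ¬ IsPseudoDivergent v x)
    (hstat : ∀ x : ℕ → K, (∀ n, x n ∈ S) → ¬ IsPseudoStationary v x)
    (hS : S.Infinite) : ∃ b ∈ S, ∃ T ⊆ S, T.Infinite ∧ ∃ γ : Γ₀, (∀ x ∈ T, v (x - b) = γ) ∧
      ∀ x ∈ T, ∀ y ∈ T, v (x - y) < γ := by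
  obtain ⟨a, ha⟩ := hS.nonempty
  obtain ⟨b, hb, hmax⟩ := exists_max_dist_of_no_pseudoDivergent v S hdiv ha
  set γ := v (b - a)
  have hdiam : ∀ x ∈ S, ∀ y ∈ S, v (x - y) ≤ γ := by
    intro x hx y hy
    have : x - y = (x - a) - (y - a) := by ring
    rw [this]
    exact (v.map_sub _ _).trans (max_le (hmax x hx) (hmax y hy))
  have hγ0 : 0 < γ := by
    obtain ⟨c, hc, hca⟩ := hS.exists_notMem_finite (Set.finite_singleton a)
    refine lt_of_lt_of_le ?_ (hmax c hc)
    rw [zero_lt_iff, v.ne_zero_iff, sub_ne_zero]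
    exact hca
  -- `γ` is the diameter of `S`. If all open balls of radius `γ` met `S` in finite sets, a greedy
  -- choice would give points at mutual distance exactly `γ`, a pseudo-stationary sequence.
  have key : ∃ c ∈ S, {x ∈ S | v (x - c) < γ}.Infinite := by
    by_contra! hfin
    obtain ⟨x, hx⟩ : ∃ x : ℕ → K, ∀ n, x n ∈ S ∧ ∀ m < n, γ ≤ v (x n - x m) := by
      have := exists_seq_of_forall_finset_exists (α := K) (fun y => y ∈ S)
        (fun y z => γ ≤ v (z - y)) (by
          intro s hs
          have hfin' : (⋃ y ∈ s, {x ∈ S | v (x - y) < γ}).Finite :=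
            s.finite_toSet.biUnion fun y hy => Set.not_infinite.1 (fun h => h (hfin y (hs y hy)))
          obtain ⟨z, hz, hz'⟩ := hS.exists_notMem_finite hfin'
          refine ⟨z, hz, fun y hy => ?_⟩
          by_contra! hlt
          exact hz' (Set.mem_biUnion hy ⟨hz, hlt⟩))
      obtain ⟨x, hx, hx'⟩ := this
      exact ⟨x, fun n => ⟨hx n, fun m hmn => hx' m n hmn⟩⟩
    have heq : ∀ m n, m < n → v (x n - x m) = γ := fun m n hmn =>
      le_antisymm (hdiam _ (hx n).1 _ (hx m).1) ((hx n).2 m hmn)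
    refine hstat x (fun n => (hx n).1) ⟨?_, fun l m n hlm hmn => by
      rw [heq _ _ hlm, heq _ _ hmn]⟩
    refine Function.Injective.of_eq_imp_le fun {m n} hxe => ?_
    by_contra! hmn
    have := heq n m hmn
    rw [hxe, sub_self, map_zero] at this
    exact hγ0.ne this
  obtain ⟨c, hc, hinf⟩ := key
  -- Since `a` and `b` are at distance `γ`, they cannot both be closer than `γ` to `c`.
  obtain ⟨b', hb', hb'c⟩ : ∃ b' ∈ S, v (b' - c) = γ := by
    by_contra! hne
    have h1 := lt_of_le_of_ne (hdiam a ha c hc) (hne a ha)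
    have h2 := lt_of_le_of_ne (hdiam b hb c hc) (hne b hb)
    have := v.map_sub_lt h2 h1
    rw [sub_sub_sub_cancel_right] at this
    exact lt_irrefl _ this
  refine ⟨b', hb', _, Set.sep_subset _ _, hinf, γ, ?_, ?_⟩
  · rintro x ⟨hx, hxc⟩
    have : x - b' = (x - c) - (b' - c) := by ring
    rw [this, v.map_sub_eq_of_lt_right (by rwa [hb'c]), hb'c]
  · rintro x ⟨hx, hxc⟩ y ⟨hy, hyc⟩
    have := v.map_sub_lt hxc hyc
    rwa [sub_sub_sub_cancel_right] at this

/-- An infinite set that contains neither a pseudo-divergent nor a pseudo-stationary sequence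
contains a pseudo-convergent one. -/
theorem exists_isPseudoConvergent (v : Valuation K Γ₀) (S : Set K)
    (hdiv : ∀ x : ℕ → K, (∀ n, x n ∈ S) → ¬ IsPseudoDivergent v x)
    (hstat : ∀ x : ℕ → K, (∀ n, x n ∈ S) → ¬ IsPseudoStationary v x)
    (hS : S.Infinite) : ∃ x γ, (∀ n, x n ∈ S) ∧ IsPseudoConvergent v x γ := by
  have step : ∀ A : {A : Set K // A ⊆ S ∧ A.Infinite}, ∃ b ∈ A.1,
      ∃ B : {A : Set K // A ⊆ S ∧ A.Infinite}, B.1 ⊆ A.1 ∧ ∃ γ : Γ₀,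
        (∀ x ∈ B.1, v (x - b) = γ) ∧ ∀ x ∈ B.1, ∀ y ∈ B.1, v (x - y) < γ := by
    rintro ⟨A, hAS, hA⟩
    obtain ⟨b, hb, T, hTA, hT, γ, h1, h2⟩ := exists_infinite_subset_of_smaller_diameter v A
      (fun x hx => hdiv x fun n => hAS (hx n)) (fun x hx => hstat x fun n => hAS (hx n)) hA
    exact ⟨b, hb, ⟨T, hTA.trans hAS, hT⟩, hTA, γ, h1, h2⟩
  choose b hb next hsub γ h1 h2 using step
  set A : ℕ → {A : Set K // A ⊆ S ∧ A.Infinite} := fun n => next^[n] ⟨S, subset_rfl, hS⟩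
  have hA : ∀ n, A (n + 1) = next (A n) := fun n => Function.iterate_succ_apply' next n _
  have hanti : Antitone fun n => (A n).1 := antitone_nat_of_succ_le fun n => by
    rw [hA]; exact hsub _
  refine ⟨fun n => b (A n), fun n => γ (A n), fun n => (A n).2.1 (hb _), ?_, ?_⟩
  · refine strictAnti_nat_of_succ_lt fun n => ?_
    -- Both `z` and `b (A (n + 1))` lie in `A (n + 1)`, and their distance is `γ (A (n + 1))`.
    obtain ⟨z, hz⟩ := (next (A (n + 1))).2.2.nonempty
    rw [← h1 (A (n + 1)) z hz]
    apply h2 (A n)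
    · rw [← hA]; exact hsub _ hz
    · rw [← hA]; exact hb _
  · intro n p hnp
    refine h1 (A n) _ ?_
    rw [← hA]
    exact hanti hnp (hb (A p))

end UltrametricSubsets

/-! ### Extension of valuations to a larger field. -/

section Extension

/-- Every valuation subring of a field is the trace of a valuation subring of a given
extension. -/
theorem ValuationSubring.exists_comap_algebraMap_eq {K : Type*} [Field K] (A : ValuationSubring K)
    (L : Type*) [Field L] [Algebra K L] :
    ∃ B : ValuationSubring L, B.comap (algebraMap K L) = A := by
  have hmem : ∀ a : A, (algebraMap K L).comp A.subtype a ∈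
      (LocalSubring.range ((algebraMap K L).comp A.subtype)).toSubring := fun a => ⟨a, rfl⟩
  obtain ⟨B, hAB, hloc⟩ :=
    (LocalSubring.range ((algebraMap K L).comp A.subtype)).exists_le_valuationSubring
  refine ⟨B, le_antisymm ?_ fun x hx => hAB (hmem ⟨x, hx⟩)⟩
  intro x hx
  by_contra hxA
  have hxinv : x⁻¹ ∈ A := (A.mem_or_inv_mem x).resolve_left hxA
  have hx0 : x ≠ 0 := by rintro rfl; exact hxA A.zero_mem
  -- `x⁻¹` becomes invertible in `B`; as `B` dominates the image of `A`, it is already invertible in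
  -- `A`.
  have hu : IsUnit (Subring.inclusion hAB ⟨_, hmem ⟨x⁻¹, hxinv⟩⟩) := by
    refine isUnit_iff_exists_inv.2 ⟨⟨algebraMap K L x, hx⟩, Subtype.ext ?_⟩
    change algebraMap K L x⁻¹ * algebraMap K L x = 1
    rw [← map_mul, inv_mul_cancel₀ hx0, map_one]
  obtain ⟨⟨_, ⟨y, rfl⟩⟩, hy⟩ := isUnit_iff_exists_inv.1 (hloc.map_nonunit _ hu)
  have hy' : algebraMap K L x⁻¹ * algebraMap K L (y : K) = 1 := congrArg Subtype.val hy
  rw [← map_mul, ← map_one (algebraMap K L), (algebraMap K L).injective.eq_iff,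
    inv_mul_eq_one₀ hx0] at hy'
  exact hxA (hy' ▸ y.2)

theorem Valuation.exists_isEquiv_comap_algebraMap {K Γ₀ : Type*} [Field K]
    [LinearOrderedCommGroupWithZero Γ₀] (v : Valuation K Γ₀) (L : Type*) [Field L] [Algebra K L] :
    ∃ B : ValuationSubring L, (B.valuation.comap (algebraMap K L)).IsEquiv v := by
  obtain ⟨B, hB⟩ := v.valuationSubring.exists_comap_algebraMap_eq L
  refine ⟨B, Valuation.isEquiv_iff_val_le_one.2 fun {x} => ?_⟩
  rw [Valuation.comap_apply, B.valuation_le_one_iff, ← v.mem_valuationSubring_iff, ← hB]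
  rfl

end Extension

/-! ### Values of a polynomial along a pseudo-convergent sequence. -/

section Kaplansky

variable {L Γ : Type*} [Field L] [LinearOrderedCommGroupWithZero Γ]

/-- `b / a` lies in the union of the maximal ideal and of the group of principal units. -/
def IsSmallOrClose (w : Valuation L Γ) (a b : L) : Prop := w b < w a ∨ w (b - a) < w a

variable {w : Valuation L Γ} {a b a' b' : L}

theorem IsSmallOrClose.le (h : IsSmallOrClose w a b) : w b ≤ w a := by
  rcases h with h | h
  · exact h.le
  · have h2 := w.map_add (b - a) a
    rw [sub_add_cancel] at h2
    exact h2.trans (max_le h.le le_rfl)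

theorem IsSmallOrClose.pos (h : IsSmallOrClose w a b) : 0 < w a := by
  rcases h with h | h <;> exact lt_of_le_of_lt zero_le h

/-- The quotient `b / a` has residue 0 or 1, and {0, 1} is closed under multiplication. -/
theorem IsSmallOrClose.mul (h : IsSmallOrClose w a b) (h' : IsSmallOrClose w a' b') :
    IsSmallOrClose w (a * a') (b * b') := by
  have hlt : ∀ {p q r s : Γ}, p < q → r ≤ s → 0 < s → p * r < q * s := fun h1 h2 h3 =>
    lt_of_le_of_lt (mul_le_mul_right h2 _) ((mul_lt_mul_iff_left₀ h3).2 h1)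
  rcases h with h1 | h1
  · left
    rw [map_mul, map_mul]
    exact hlt h1 h'.le h'.pos
  · rcases h' with h2 | h2
    · left
      rw [map_mul, map_mul, mul_comm (w b), mul_comm (w a)]
      exact hlt h2 (IsSmallOrClose.le (Or.inr h1)) (IsSmallOrClose.pos (Or.inr h1))
    · right
      have : b * b' - a * a' = (b - a) * b' + (b' - a') * a := by ring
      rw [this]
      refine w.map_add_lt ?_ ?_
      · rw [map_mul, map_mul]
        exact hlt h1 (IsSmallOrClose.le (Or.inr h2)) (IsSmallOrClose.pos (Or.inr h2))
      · rw [map_mul, map_mul, mul_comm (w a)]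
        exact hlt h2 le_rfl (IsSmallOrClose.pos (Or.inr h1))

/-- If `α` is not a pseudo-limit, `w (x n - α)` is eventually constant and exceeds `γ n`, so the
quotients are principal units. If `α` is a pseudo-limit, `w (x n - α) = γ n` decreases strictly, so
the quotients are small. -/
theorem IsPseudoConvergent.isSmallOrClose_sub {x : ℕ → L} {γ : ℕ → Γ}
    (h : IsPseudoConvergent w x γ) (α : L) :
    ∃ N, ∀ n p, N ≤ n → n < p → IsSmallOrClose w (x n - α) (x p - α) := by
  by_cases hα : ∃ N, γ N < w (x N - α)
  · obtain ⟨N, hN⟩ := hα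
    have hconst : ∀ n, N ≤ n → w (x n - α) = w (x N - α) := by
      intro n hn
      rcases hn.eq_or_lt with rfl | hn
      · rfl
      · have h1 : x n - α = (x n - x N) + (x N - α) := by ring
        rw [h1, w.map_add_eq_of_lt_right (by rwa [h.2 N n hn])]
    refine ⟨N, fun n p hn hnp => Or.inr ?_⟩
    rw [sub_sub_sub_cancel_right, h.2 n p hnp, hconst n hn]
    exact lt_of_le_of_lt (h.1.antitone hn) hN
  · push Not at hα
    refine ⟨0, fun n p _ hnp => Or.inl ?_⟩
    have h1 : w (x p - α) < γ n := lt_of_le_of_lt (hα p) (h.1 hnp)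
    have h2 : x n - α = (x p - α) - (x p - x n) := by ring
    have h3 := w.map_sub_eq_of_lt_right (x := x p - α) (y := x p - x n) (by rwa [h.2 n p hnp])
    rw [h2, h3, h.2 n p hnp]
    exact h1

theorem IsPseudoConvergent.isSmallOrClose_eval_of_splits {x : ℕ → L} {γ : ℕ → Γ}
    (h : IsPseudoConvergent w x γ) {F : L[X]} (hF : F ≠ 0) (hs : F.Splits) :
    ∃ N, ∀ n p, N ≤ n → n < p → IsSmallOrClose w (F.eval (x n)) (F.eval (x p)) := by
  have key : ∀ s : Multiset L, ∃ N, ∀ n p, N ≤ n → n < p →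
      IsSmallOrClose w (s.map (x n - ·)).prod (s.map (x p - ·)).prod := by
    intro s
    induction s using Multiset.induction with
    | empty => exact ⟨0, fun _ _ _ _ => Or.inr (by simp)⟩
    | cons α s ih =>
      obtain ⟨N, hN⟩ := ih
      obtain ⟨N', hN'⟩ := h.isSmallOrClose_sub α
      refine ⟨max N N', fun n p hn hnp => ?_⟩
      rw [Multiset.map_cons, Multiset.map_cons, Multiset.prod_cons, Multiset.prod_cons]
      exact (hN' n p (le_of_max_le_right hn) hnp).mul (hN n p (le_of_max_le_left hn) hnp)
  obtain ⟨N, hN⟩ := key F.roots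
  refine ⟨N, fun n p hn hnp => ?_⟩
  rw [hs.eval_eq_prod_roots, hs.eval_eq_prod_roots]
  refine IsSmallOrClose.mul (Or.inr ?_) (hN n p hn hnp)
  rw [sub_self, map_zero, zero_lt_iff, w.ne_zero_iff]
  exact Polynomial.leadingCoeff_ne_zero.2 hF

/-- Along a pseudo-convergent sequence, the ratio of two values of a polynomial eventually lies in
the maximal ideal or is a principal unit. -/
theorem IsPseudoConvergent.isSmallOrClose_eval {x : ℕ → L} {γ : ℕ → Γ}
    (h : IsPseudoConvergent w x γ) {F : L[X]} (hF : F ≠ 0) :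
    ∃ N, ∀ n p, N ≤ n → n < p → IsSmallOrClose w (F.eval (x n)) (F.eval (x p)) := by
  obtain ⟨B, hB⟩ := w.exists_isEquiv_comap_algebraMap (AlgebraicClosure L)
  have hlt : ∀ a b : L, B.valuation (algebraMap L (AlgebraicClosure L) a) <
      B.valuation (algebraMap L (AlgebraicClosure L) b) ↔ w a < w b := fun a b =>
    Valuation.isEquiv_iff_val_lt_val.1 hB
  have heq : ∀ a b : L, B.valuation (algebraMap L (AlgebraicClosure L) a) =
      B.valuation (algebraMap L (AlgebraicClosure L) b) ↔ w a = w b := fun a b => hB.eq_iff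
  -- `B` has its own value group, so the gauge is read off from consecutive differences.
  have hpc : IsPseudoConvergent B.valuation (fun n => algebraMap L (AlgebraicClosure L) (x n))
      (fun n => B.valuation (algebraMap L (AlgebraicClosure L) (x (n + 1) - x n))) := by
    refine ⟨fun m n hmn => ?_, fun n p hnp => ?_⟩
    · rw [hlt, h.2 _ _ (Nat.lt_succ_self n), h.2 _ _ (Nat.lt_succ_self m)]
      exact h.1 hmn
    · rw [← map_sub, heq, h.2 _ _ (Nat.lt_succ_self n), h.2 _ _ hnp]
  obtain ⟨N, hN⟩ := hpc.isSmallOrClose_eval_of_splits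
    ((Polynomial.map_ne_zero_iff (algebraMap L (AlgebraicClosure L)).injective).2 hF)
    (IsAlgClosed.splits _)
  refine ⟨N, fun n p hn hnp => ?_⟩
  have := hN n p hn hnp
  rwa [Polynomial.eval_map_algebraMap, Polynomial.eval_map_algebraMap,
    Polynomial.aeval_algebraMap_apply, Polynomial.aeval_algebraMap_apply, IsSmallOrClose,
    ← map_sub, hlt, hlt] at this

theorem IsPseudoConvergent.injective {x : ℕ → L} {γ : ℕ → Γ} (h : IsPseudoConvergent w x γ) :
    Function.Injective x := by
  refine Function.Injective.of_eq_imp_le fun {m n} hxe => ?_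
  by_contra! hmn
  have := h.2 n m hmn
  rw [hxe, sub_self, map_zero] at this
  exact not_lt_zero (this ▸ h.1 (Nat.lt_succ_self n))

end Kaplansky

/-! ### Finiteness and maximum principles for polynomial values. -/

section PolynomialValues

variable {K Γ₀ : Type*} [Field K] [LinearOrderedCommGroupWithZero Γ₀]

/-- Every infinite subset of `S` contains a pseudo-convergent sequence. -/
def HasPseudoConvergentSubsequences (v : Valuation K Γ₀) (S : Set K) : Prop :=
  ∀ T ⊆ S, T.Infinite → ∃ x γ, (∀ n, x n ∈ T) ∧ IsPseudoConvergent v x γ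

variable {v : Valuation K Γ₀} {S : Set K}

/-- There is no infinite subset of `S` on which the differences of distinct values of a polynomial
all have valuation one. -/
theorem HasPseudoConvergentSubsequences.finite_of_val_eval_sub_eq_one
    (hS : HasPseudoConvergentSubsequences v S) (F : K[X]) {T : Set K} (hT : T ⊆ S)
    (hdist : ∀ s ∈ T, ∀ t ∈ T, s ≠ t → v (F.eval s - F.eval t) = 1) : T.Finite := by
  by_contra hinf
  obtain ⟨x, γ, hxT, hx⟩ := hS T hT hinf
  -- Away from index 0, the values of `G` and their differences all have valuation one, so their
  -- quotients have residue neither 0 nor 1.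
  set G := F - Polynomial.C (F.eval (x 0)) with hG
  have hGe : ∀ n, G.eval (x n) = F.eval (x n) - F.eval (x 0) := fun n => by simp [hG]
  have hne : ∀ m n, m ≠ n → v (F.eval (x m) - F.eval (x n)) = 1 := fun m n hmn =>
    hdist _ (hxT m) _ (hxT n) (hx.injective.ne hmn)
  have hG1 : ∀ n, n ≠ 0 → v (G.eval (x n)) = 1 := fun n hn => by rw [hGe]; exact hne n 0 hn
  have hG0 : G ≠ 0 := by
    intro h0
    have := hG1 1 one_ne_zero
    simp [h0] at this
  obtain ⟨N, hN⟩ := hx.isSmallOrClose_eval hG0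
  have := hN (N + 1) (N + 2) (by omega) (by omega)
  rw [IsSmallOrClose, hG1 _ (by omega), hG1 _ (by omega), hGe, hGe, sub_sub_sub_cancel_right,
    hne _ _ (by omega)] at this
  simp at this

/-- The valuation of a polynomial attains its maximum on `S`. -/
theorem HasPseudoConvergentSubsequences.exists_max_val_eval
    (hS : HasPseudoConvergentSubsequences v S) (F : K[X]) (hne : S.Nonempty) :
    ∃ s ∈ S, ∀ t ∈ S, v (F.eval t) ≤ v (F.eval s) := by
  by_contra! hcon
  choose! f hfS hf using hcon
  obtain ⟨a, ha⟩ := hne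
  set x : ℕ → K := fun n => f^[n] a
  have hxs : ∀ n, x (n + 1) = f (x n) := fun n => Function.iterate_succ_apply' f n a
  have hxS : ∀ n, x n ∈ S := by
    intro n
    induction n with
    | zero => exact ha
    | succ n ih => rw [hxs]; exact hfS _ ih
  have hmono : StrictMono fun n => v (F.eval (x n)) :=
    strictMono_nat_of_lt_succ fun n => by rw [hxs]; exact hf _ (hxS n)
  have hinj : Function.Injective x := fun m n hmn =>
    hmono.injective (congrArg (fun z => v (F.eval z)) hmn)
  obtain ⟨y, γ, hy, hpc⟩ := hS (Set.range x) (Set.range_subset_iff.2 hxS)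
    (Set.infinite_range_of_injective hinj)
  choose i hi using hy
  have hF : F ≠ 0 := by
    rintro rfl
    have := hmono Nat.zero_lt_one
    simp at this
  obtain ⟨N, hN⟩ := hpc.isSmallOrClose_eval hF
  -- Valuations of values increase along `x` but eventually do not increase along the subfamily `y n
  -- = x (i n)`, so the indices would descend forever.
  have hanti : StrictAnti fun n => i (N + n) := by
    refine strictAnti_nat_of_succ_lt fun n => ?_
    have hle := (hN (N + n) (N + (n + 1)) (by omega) (by omega)).le
    rw [← hi, ← hi] at hle
    refine lt_of_le_of_ne (hmono.le_iff_le.1 hle) fun heq => ?_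
    have := congrArg x heq
    rw [hi, hi] at this
    have := hpc.injective this
    omega
  exact (RelEmbedding.natGT _ fun n => hanti n.lt_succ_self).not_wellFounded wellFounded_lt

/-- Powers of an element of valuation less than one become arbitrarily small in rank one. -/
theorem Valuation.exists_pow_le_of_rankOne (v : Valuation K Γ₀) [v.RankOne] {x y : K}
    (hx : v x < 1) (hy : y ≠ 0) : ∃ n : ℕ, v x ^ n ≤ v y := by
  have hpos : 0 < Valuation.RankOne.hom v (v.restrict y) := by
    rw [zero_lt_iff]
    intro h0
    have := Valuation.RankOne.zero_of_hom_zero v h0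
    rw [v.restrict_eq_zero_iff, v.zero_iff] at this
    exact hy this
  have hlt : Valuation.RankOne.hom v (v.restrict x) < 1 := by
    rw [← map_one (Valuation.RankOne.hom v)]
    exact Valuation.RankOne.strictMono v (v.restrict_lt_one_iff.2 hx)
  obtain ⟨n, hn⟩ := exists_pow_lt_of_lt_one hpos hlt
  refine ⟨n, ?_⟩
  rw [← map_pow, ← map_pow] at hn
  have := (Valuation.RankOne.strictMono v).lt_iff_lt.1 hn
  rw [v.restrict_lt_iff] at this
  rw [← map_pow]
  exact this.le

end PolynomialValues

/-! ### Residues on E, indicator functions, ideals containing a constant. -/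

section Residues

variable {K Γ₀ : Type*} [Field K] [LinearOrderedCommGroupWithZero Γ₀] {v : Valuation K Γ₀}
  {E : Set v.valuationSubring}

theorem mem_integerValuedPolynomials_iff {F : K[X]} :
    F ∈ integerValuedPolynomials K E ↔ ∀ a ∈ E, v (F.eval (a : K)) ≤ 1 := by
  refine forall₂_congr fun a _ => ?_
  constructor
  · rintro ⟨b, hb⟩
    have hb' : (b : K) = F.eval (a : K) := hb
    rw [← hb']
    exact b.2
  · exact fun h => ⟨⟨_, h⟩, rfl⟩

/-- The constants of `Int(E, V)`. -/
noncomputable def integerValuedPolynomials.const (E : Set v.valuationSubring) :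
    v.valuationSubring →+* integerValuedPolynomials K E :=
  RingHom.codRestrict ((Polynomial.C : K →+* K[X]).comp v.valuationSubring.subtype) _ fun c =>
    mem_integerValuedPolynomials_iff.2 fun a _ => by
      rw [RingHom.comp_apply, Polynomial.eval_C]; exact c.2

/-- Reduction of the value at `a ∈ E` modulo the maximal ideal. -/
noncomputable def integerValuedPolynomials.residueAt (a : E) :
    integerValuedPolynomials K E →+* IsLocalRing.ResidueField v.valuationSubring :=
  (IsLocalRing.residue v.valuationSubring).comp
    (RingHom.codRestrict ((Polynomial.evalRingHom (a.1 : K)).comp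
      (integerValuedPolynomials K E).subtype) v.valuationSubring
      fun F => mem_integerValuedPolynomials_iff.1 F.2 a.1 a.2)

namespace integerValuedPolynomials

theorem coe_const (c : v.valuationSubring) :
    (const E c : K[X]) = Polynomial.C (c : K) := rfl

theorem const_injective : Function.Injective (const (K := K) E) := fun _ _ h =>
  Subtype.ext (Polynomial.C_injective (congrArg Subtype.val h))

theorem residueAt_eq_zero_iff (a : E) (F : integerValuedPolynomials K E) :
    residueAt a F = 0 ↔ v ((F : K[X]).eval (a.1 : K)) < 1 := by
  rw [residueAt, RingHom.comp_apply, IsLocalRing.residue_eq_zero_iff,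
    ValuationSubring.valuation_lt_one_iff]
  exact (Valuation.isEquiv_iff_val_lt_one.1 v.isEquiv_valuation_valuationSubring).symm

theorem residueAt_const (a : E) (c : v.valuationSubring) :
    residueAt a (const E c) = IsLocalRing.residue _ c := by
  rw [residueAt, RingHom.comp_apply]
  congr 1
  exact Subtype.ext (Polynomial.eval_C)

/-- Choosing one point of `E` for each residue gives a set on which values differ pairwise by units
of V; such a set is finite. -/
theorem finite_range_residueAt (hE : HasPseudoConvergentSubsequences v ((↑) '' E))
    (F : integerValuedPolynomials K E) : (Set.range fun a : E => residueAt a F).Finite := by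
  obtain ⟨T, hT⟩ := Set.SurjOn.exists_bijOn_subset
    (Set.surjOn_image (fun a : E => residueAt a F) Set.univ)
  rw [← Set.image_univ, ← hT.2.image_eq]
  refine Set.Finite.image _ ?_
  have hinj : Function.Injective fun a : E => (a.1 : K) :=
    Subtype.val_injective.comp Subtype.val_injective
  refine Set.Finite.of_finite_image (f := fun a : E => (a.1 : K)) ?_ hinj.injOn
  refine hE.finite_of_val_eval_sub_eq_one (F : K[X]) ?_ ?_
  · rintro _ ⟨a, -, rfl⟩
    exact ⟨a.1, a.2, rfl⟩
  · rintro _ ⟨a, ha, rfl⟩ _ ⟨b, hb, rfl⟩ hab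
    refine le_antisymm ((v.map_sub _ _).trans (max_le
      (mem_integerValuedPolynomials_iff.1 F.2 _ a.2)
      (mem_integerValuedPolynomials_iff.1 F.2 _ b.2))) ?_
    by_contra! hlt
    refine hab (congrArg (fun a : E => (a.1 : K)) (hT.2.injOn ha hb ?_))
    set c : v.valuationSubring := ⟨(F : K[X]).eval (b.1 : K),
      mem_integerValuedPolynomials_iff.1 F.2 _ b.2⟩
    have h1 : residueAt a (F - const E c) = 0 := by
      rw [residueAt_eq_zero_iff]
      simpa [coe_const, c] using hlt
    have h2 : residueAt b (F - const E c) = 0 := by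
      rw [residueAt_eq_zero_iff]
      simp [coe_const, c]
    rw [map_sub, residueAt_const, sub_eq_zero] at h1 h2
    exact h1.trans h2.symm

/-- The indicator function modulo the maximal ideal of the joint support of finitely many
integer-valued polynomials. -/
theorem exists_indicator (hE : HasPseudoConvergentSubsequences v ((↑) '' E)) {ι : Type*}
    [Fintype ι] (F : ι → integerValuedPolynomials K E) :
    ∃ e ∈ Ideal.span (Set.range F), ∀ a : E, ((∀ i, residueAt a (F i) = 0) → residueAt a e = 0) ∧
      ((∃ i, residueAt a (F i) ≠ 0) → residueAt a e = 1) := by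
  classical
  have key : ∀ i, ∃ g, ∀ a : E, residueAt a (F i) ≠ 0 → residueAt a (1 - g * F i) = 0 := by
    intro i
    set s := (finite_range_residueAt hE (F i)).toFinset.erase 0
    choose lift hlift using
      IsLocalRing.residue_surjective (R := v.valuationSubring)
    -- `s` is the finite set of nonzero residues of `F i`; the factor at `r` vanishes wherever the
    -- residue is `r`.
    obtain ⟨g, hg⟩ : F i ∣ 1 - ∏ r ∈ s, (1 - const E (lift r⁻¹) * F i) := by
      rw [← Ideal.mem_span_singleton, ← Ideal.Quotient.eq_zero_iff_mem]
      have h0 : Ideal.Quotient.mk (Ideal.span {F i}) (F i) = 0 :=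
        Ideal.Quotient.eq_zero_iff_mem.2 (Ideal.mem_span_singleton_self _)
      simp [h0]
    refine ⟨g, fun a ha => ?_⟩
    rw [mul_comm, ← hg, sub_sub_cancel, map_prod]
    refine Finset.prod_eq_zero (i := residueAt a (F i)) (by simp [s, ha]) ?_
    rw [map_sub, map_mul, map_one, residueAt_const, hlift, inv_mul_cancel₀ ha, sub_self]
  choose g hg using key
  have hmem : 1 - ∏ i, (1 - g i * F i) ∈ Ideal.span (Set.range F) := by
    rw [← Ideal.Quotient.eq_zero_iff_mem]
    have h0 : ∀ i, Ideal.Quotient.mk (Ideal.span (Set.range F)) (F i) = 0 := fun i =>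
      Ideal.Quotient.eq_zero_iff_mem.2 (Ideal.subset_span ⟨i, rfl⟩)
    simp [h0]
  refine ⟨_, hmem, fun a => ⟨fun ha => ?_, ?_⟩⟩
  · simp [ha]
  · rintro ⟨i, hi⟩
    rw [map_sub, map_one, map_prod, Finset.prod_eq_zero (Finset.mem_univ i) (hg i a hi), sub_zero]

/-- An integer-valued polynomial whose values lie in the maximal ideal is nilpotent modulo every
nonzero constant. -/
theorem exists_pow_mem_span_const [v.RankOne]
    (hE : HasPseudoConvergentSubsequences v ((↑) '' E)) (F : integerValuedPolynomials K E)
    (hF : ∀ a, residueAt a F = 0) {c : v.valuationSubring} (hc : c ≠ 0) :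
    ∃ n, F ^ n ∈ Ideal.span {const E c} := by
  have hc' : (c : K) ≠ 0 := fun h => hc (Subtype.ext h)
  obtain ⟨n, hn⟩ : ∃ n : ℕ, ∀ a ∈ E, v ((F : K[X]).eval (a : K)) ^ n ≤ v c := by
    rcases E.eq_empty_or_nonempty with rfl | hne
    · exact ⟨0, fun a ha => ha.elim⟩
    -- An attained maximum is still less than one, so a single exponent serves all of `E`.
    · obtain ⟨_, ⟨s, hs, rfl⟩, hmax⟩ := hE.exists_max_val_eval (F : K[X]) (hne.image _)
      obtain ⟨n, hn⟩ := v.exists_pow_le_of_rankOne ((residueAt_eq_zero_iff ⟨s, hs⟩ F).1 (hF _)) hc'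
      exact ⟨n, fun a ha => (pow_le_pow_left₀ zero_le (hmax _ ⟨a, ha, rfl⟩) n).trans hn⟩
  refine ⟨n, Ideal.mem_span_singleton.2 ⟨⟨Polynomial.C (c : K)⁻¹ * (F : K[X]) ^ n, ?_⟩, ?_⟩⟩
  · refine mem_integerValuedPolynomials_iff.2 fun a ha => ?_
    rw [Polynomial.eval_mul, Polynomial.eval_C, Polynomial.eval_pow, map_mul, map_pow, map_inv₀,
      mul_comm, ← div_eq_mul_inv]
    exact div_le_one_of_le₀ (hn a ha) zero_le
  · refine Subtype.ext ?_
    simp only [Subring.coe_mul, SubmonoidClass.coe_pow, coe_const]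
    rw [← mul_assoc, ← Polynomial.C_mul, mul_inv_cancel₀ hc', Polynomial.C_1, one_mul]

/-- An ideal containing a nonzero constant and finitely many integer-valued polynomials without
common zero modulo the maximal ideal is the unit ideal. -/
theorem ideal_eq_top_of_const_mem [v.RankOne]
    (hE : HasPseudoConvergentSubsequences v ((↑) '' E)) {J : Ideal (integerValuedPolynomials K E)}
    {c : v.valuationSubring} (hc : c ≠ 0) (hcJ : const E c ∈ J) {ι : Type*} [Fintype ι]
    (F : ι → integerValuedPolynomials K E) (hFJ : ∀ i, F i ∈ J)
    (hF : ∀ a : E, ∃ i, residueAt a (F i) ≠ 0) : J = ⊤ := by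
  obtain ⟨e, heF, he⟩ := exists_indicator hE F
  have heJ : e ∈ J := Ideal.span_le.2 (Set.range_subset_iff.2 hFJ) heF
  obtain ⟨n, hn⟩ := exists_pow_mem_span_const hE (1 - e)
    (fun a => by rw [map_sub, map_one, (he a).2 (hF a), sub_self]) hc
  have hnJ : (1 - e) ^ n ∈ J := Ideal.span_le.2 (Set.singleton_subset_iff.2 hcJ) hn
  rw [← Ideal.Quotient.eq_zero_iff_mem, map_pow, map_sub, map_one,
    Ideal.Quotient.eq_zero_iff_mem.2 heJ, sub_zero, one_pow] at hnJ
  rw [Ideal.eq_top_iff_one, ← Ideal.Quotient.eq_zero_iff_mem, map_one, hnJ]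

end integerValuedPolynomials

end Residues

/-! ### Roots in the algebraic closure and the unit ideal criterion. -/

section Roots

variable {K Γ₀ : Type*} [Field K] [LinearOrderedCommGroupWithZero Γ₀] {v : Valuation K Γ₀}
  {E : Set v.valuationSubring}

/-- Evaluation of integer-valued polynomials at an element of the algebraic closure. -/
noncomputable def integerValuedPolynomials.evalAlgebraicClosure (E : Set v.valuationSubring)
    (α : AlgebraicClosure K) : integerValuedPolynomials K E →+* AlgebraicClosure K :=
  (Polynomial.aeval α : K[X] →ₐ[K] AlgebraicClosure K).toRingHom.comp
    (integerValuedPolynomials K E).subtype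

namespace integerValuedPolynomials

theorem evalAlgebraicClosure_apply (α : AlgebraicClosure K) (F : integerValuedPolynomials K E) :
    evalAlgebraicClosure E α F = Polynomial.aeval α (F : K[X]) := rfl

theorem evalAlgebraicClosure_const (α : AlgebraicClosure K) (c : v.valuationSubring) :
    evalAlgebraicClosure E α (const E c) = algebraMap K _ (c : K) :=
  Polynomial.aeval_C _ _

theorem exists_const_mul_mem (E : Set v.valuationSubring) (F : K[X]) :
    ∃ c : v.valuationSubring, c ≠ 0 ∧
      Polynomial.C (c : K) * F ∈ integerValuedPolynomials K E := by
  induction F using Polynomial.induction_on' with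
  | add p q hp hq =>
    obtain ⟨c, hc, hcp⟩ := hp
    obtain ⟨d, hd, hdq⟩ := hq
    refine ⟨c * d, mul_ne_zero hc hd, ?_⟩
    have : Polynomial.C ((c * d : v.valuationSubring) : K) * (p + q) =
        (const E d : K[X]) * (Polynomial.C (c : K) * p) +
          (const E c : K[X]) * (Polynomial.C (d : K) * q) := by
      rw [coe_const, coe_const, MulMemClass.coe_mul, Polynomial.C_mul]
      ring
    rw [this]
    exact add_mem (mul_mem (const E d).2 hcp) (mul_mem (const E c).2 hdq)
  | monomial n a =>
    obtain ⟨c, hc, hca⟩ : ∃ c : v.valuationSubring, c ≠ 0 ∧ v (c * a) ≤ 1 := by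
      rcases le_total (v a) 1 with h | h
      · exact ⟨1, one_ne_zero, by simpa using h⟩
      · have ha : a ≠ 0 := by
          rintro rfl
          simp at h
        refine ⟨⟨a⁻¹, ?_⟩, ?_, ?_⟩
        · rw [v.mem_valuationSubring_iff, map_inv₀]
          exact inv_le_one_of_one_le₀ h
        · exact fun h0 => inv_ne_zero ha (congrArg Subtype.val h0)
        · simp [ha]
    refine ⟨c, hc, mem_integerValuedPolynomials_iff.2 fun b _ => ?_⟩
    rw [Polynomial.C_mul_monomial, Polynomial.eval_monomial, map_mul, map_pow]
    exact mul_le_one' hca (pow_le_one' b.2 n)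

/-- Every polynomial over K becomes integer-valued after scaling by a nonzero constant, so the
extension of `J` to K[X] is proper; any root of its generator works. -/
theorem exists_common_root_of_const_notMem {J : Ideal (integerValuedPolynomials K E)}
    (hJ : ∀ c, c ≠ 0 → const E c ∉ J) {g : integerValuedPolynomials K E} (hg : g ≠ 0)
    (hgJ : g ∈ J) : ∃ α, ∀ F ∈ J, evalAlgebraicClosure E α F = 0 := by
  set I := J.map (integerValuedPolynomials K E).subtype
  have hden : ∀ z ∈ I, ∃ c : v.valuationSubring, c ≠ 0 ∧ ∃ F ∈ J,
      (F : K[X]) = Polynomial.C (c : K) * z := by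
    intro z hz
    induction hz using Submodule.span_induction with
    | mem z hz =>
      obtain ⟨F, hF, rfl⟩ := hz
      exact ⟨1, one_ne_zero, F, hF, by simp⟩
    | zero => exact ⟨1, one_ne_zero, 0, zero_mem _, by simp⟩
    | add x y _ _ hx hy =>
      obtain ⟨c, hc, F, hF, hFx⟩ := hx
      obtain ⟨d, hd, G, hG, hGy⟩ := hy
      refine ⟨c * d, mul_ne_zero hc hd, const E d * F + const E c * G,
        add_mem (J.mul_mem_left _ hF) (J.mul_mem_left _ hG), ?_⟩
      rw [Subring.coe_add, Subring.coe_mul, Subring.coe_mul, hFx, hGy, coe_const, coe_const,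
        MulMemClass.coe_mul, Polynomial.C_mul]
      ring
    | smul p x _ hx =>
      obtain ⟨c, hc, F, hF, hFx⟩ := hx
      obtain ⟨d, hd, hdp⟩ := exists_const_mul_mem E p
      refine ⟨d * c, mul_ne_zero hd hc, ⟨_, hdp⟩ * F, J.mul_mem_left _ hF, ?_⟩
      rw [Subring.coe_mul, hFx, MulMemClass.coe_mul, Polynomial.C_mul, smul_eq_mul]
      ring
  have hgen : Ideal.span {Submodule.IsPrincipal.generator I} = I := I.span_singleton_generator
  set q := Submodule.IsPrincipal.generator I
  have hdvd : ∀ F ∈ J, q ∣ (F : K[X]) := fun F hF => by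
    rw [← Ideal.mem_span_singleton, hgen]
    exact Ideal.mem_map_of_mem (integerValuedPolynomials K E).subtype hF
  have hq0 : q ≠ 0 := by
    intro h0
    have := hdvd g hgJ
    rw [h0, zero_dvd_iff] at this
    exact hg (Subtype.ext this)
  have hqu : ¬ IsUnit q := by
    intro hu
    have h1 : (1 : K[X]) ∈ I := by
      rw [← hgen, Ideal.span_singleton_eq_top.2 hu]
      trivial
    obtain ⟨c, hc, F, hF, hFc⟩ := hden 1 h1
    refine hJ c hc ?_
    rwa [show const E c = F from Subtype.ext (by rw [hFc, mul_one, coe_const])]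
  obtain ⟨α, hα⟩ := IsAlgClosed.exists_aeval_eq_zero (AlgebraicClosure K) q
    (fun h0 => hqu (Polynomial.isUnit_iff_degree_eq_zero.2 h0))
  refine ⟨α, fun F hF => ?_⟩
  obtain ⟨r, hr⟩ := hdvd F hF
  rw [evalAlgebraicClosure_apply, hr, map_mul, hα, zero_mul]

/-- A criterion for an ideal to be the unit ideal: it has no zero modulo the maximal ideal on `E`
and no zero in the algebraic closure. -/
theorem ideal_eq_top_of_no_zero [v.RankOne]
    (hE : HasPseudoConvergentSubsequences v ((↑) '' E)) {J : Ideal (integerValuedPolynomials K E)}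
    {g : integerValuedPolynomials K E} (hg : g ≠ 0) (hgJ : g ∈ J) {ι : Type*} [Fintype ι]
    (F : ι → integerValuedPolynomials K E) (hFJ : ∀ i, F i ∈ J)
    (hF : ∀ a : E, ∃ i, residueAt a (F i) ≠ 0)
    (hroot : ∀ α, ∃ G ∈ J, evalAlgebraicClosure E α G ≠ 0) : J = ⊤ := by
  by_cases hJ : ∀ c, c ≠ 0 → const E c ∉ J
  · obtain ⟨α, hα⟩ := exists_common_root_of_const_notMem hJ hg hgJ
    obtain ⟨G, hG, hG0⟩ := hroot α
    exact (hG0 (hα G hG)).elim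
  · push Not at hJ
    obtain ⟨c, hc, hcJ⟩ := hJ
    exact ideal_eq_top_of_const_mem hE hc hcJ F hFJ hF

theorem finite_roots {g : integerValuedPolynomials K E} (hg : g ≠ 0) :
    {α | evalAlgebraicClosure E α g = 0}.Finite := by
  have hg' : (g : K[X]) ≠ 0 := fun h => hg (Subtype.ext h)
  refine ((g : K[X]).rootSet_finite (AlgebraicClosure K)).subset fun α hα => ?_
  rw [Polynomial.mem_rootSet]
  exact ⟨hg', hα⟩

theorem exists_const_residue_eq_zero (v : Valuation K Γ₀) [v.IsNontrivial] :
    ∃ d : v.valuationSubring, d ≠ 0 ∧ IsLocalRing.residue _ d = 0 := by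
  obtain ⟨d, hd0, hd1⟩ := Valuation.IsNontrivial.exists_lt_one (v := v)
  refine ⟨⟨d, hd1.le⟩, ?_, ?_⟩
  · exact fun h => hd0 (congrArg Subtype.val h)
  · rw [IsLocalRing.residue_eq_zero_iff, ValuationSubring.valuation_lt_one_iff]
    exact (Valuation.isEquiv_iff_val_lt_one.1 v.isEquiv_valuation_valuationSubring).1 hd1

theorem infinite_valuationSubring (v : Valuation K Γ₀) [v.IsNontrivial] :
    Infinite v.valuationSubring := by
  obtain ⟨d, hd0, hd⟩ := exists_const_residue_eq_zero v
  by_contra hfin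
  rw [not_infinite_iff_finite] at hfin
  obtain ⟨u, hu⟩ := (Finite.isDomain_to_isField v.valuationSubring).mul_inv_cancel hd0
  have := congrArg (IsLocalRing.residue _) hu
  rw [map_mul, hd, zero_mul, map_one] at this
  exact zero_ne_one this

end integerValuedPolynomials

end Roots

/-! ### The almost local-global property. -/

section LocalGlobal

theorem MvPolynomial.map_eval_eq_eval₂ {σ A B : Type*} [CommSemiring A] [CommSemiring B]
    (φ : A →+* B) (y : σ → A) (f : MvPolynomial σ A) :
    φ (MvPolynomial.eval y f) = MvPolynomial.eval₂ φ (fun i => φ (y i)) f :=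
  MvPolynomial.eval₂_comp_left φ (RingHom.id A) y f

variable {K Γ₀ : Type*} [Field K] [LinearOrderedCommGroupWithZero Γ₀] {v : Valuation K Γ₀}
  {E : Set v.valuationSubring}

namespace integerValuedPolynomials

/-- Glueing of values of a polynomial modulo the maximal ideal. -/
theorem exists_eval_residueAt_ne_zero (hE : HasPseudoConvergentSubsequences v ((↑) '' E))
    {σ : Type*} (f : MvPolynomial σ (integerValuedPolynomials K E))
    {c : integerValuedPolynomials K E}
    (hc : c ∈ Ideal.span (Set.range fun y => MvPolynomial.eval y f)) :
    ∃ y, ∀ a : E, residueAt a c ≠ 0 → residueAt a (MvPolynomial.eval y f) ≠ 0 := by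
  have hmap : ∀ (a : E) (y z : σ → integerValuedPolynomials K E),
      (∀ i, residueAt a (y i) = residueAt a (z i)) →
        residueAt a (MvPolynomial.eval y f) = residueAt a (MvPolynomial.eval z f) := by
    intro a y z h
    rw [MvPolynomial.map_eval_eq_eval₂, MvPolynomial.map_eval_eq_eval₂]
    congr 1
    exact funext h
  induction hc using Submodule.span_induction with
  | mem _ h =>
    obtain ⟨y, rfl⟩ := h
    exact ⟨y, fun _ h => h⟩
  | zero => exact ⟨0, fun a h => (h (map_zero _)).elim⟩
  | add c d _ _ hc hd =>
    obtain ⟨y, hy⟩ := hc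
    obtain ⟨z, hz⟩ := hd
    obtain ⟨e, -, he⟩ := exists_indicator hE fun _ : Unit => MvPolynomial.eval y f
    -- Modulo the maximal ideal this is `y` where `f` has nonzero residue at `y`, and `z` elsewhere.
    refine ⟨fun i => e * y i + (1 - e) * z i, fun a ha => ?_⟩
    by_cases hya : residueAt a (MvPolynomial.eval y f) = 0
    · have he0 := (he a).1 fun _ => hya
      rw [hmap a _ z fun i => by simp [he0]]
      refine hz a fun hd0 => ha ?_
      rw [map_add, hd0, add_zero]
      by_contra hc0
      exact hy a hc0 hya
    · have he1 := (he a).2 ⟨(), hya⟩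
      rwa [hmap a _ y fun i => by simp [he1]]
  | smul r c _ hc =>
    obtain ⟨y, hy⟩ := hc
    refine ⟨y, fun a ha => hy a fun h0 => ha ?_⟩
    rw [smul_eq_mul, map_mul, h0, mul_zero]

/-- A polynomial over `Int(E, V)` whose values generate the unit ideal modulo a nonzero ideal takes
a unit value modulo this ideal. -/
theorem exists_span_eval_sup_eq_top [v.RankOne]
    (hE : HasPseudoConvergentSubsequences v ((↑) '' E)) {I : Ideal (integerValuedPolynomials K E)}
    (hI : I ≠ ⊥) {σ : Type*} (f : MvPolynomial σ (integerValuedPolynomials K E))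
    (hf : Ideal.span (Set.range fun y => MvPolynomial.eval y f) ⊔ I = ⊤) :
    ∃ y, Ideal.span {MvPolynomial.eval y f} ⊔ I = ⊤ := by
  obtain ⟨g, hgI, hg⟩ := Submodule.exists_mem_ne_zero_of_ne_bot hI
  obtain ⟨c, hc, h, hh, hch⟩ := Submodule.mem_sup.1 ((Ideal.eq_top_iff_one _).1 hf)
  obtain ⟨y₀, hy₀⟩ := exists_eval_residueAt_ne_zero hE f hc
  obtain ⟨d, hd, hdres⟩ := exists_const_residue_eq_zero v
  have hfin := finite_roots hg
  -- a translation by multiples of `d` which avoids zeros at the roots of `g`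
  obtain ⟨t, ht⟩ : ∃ t : σ → v.valuationSubring, ∀ α, evalAlgebraicClosure E α g = 0 →
      (∃ y, evalAlgebraicClosure E α (MvPolynomial.eval y f) ≠ 0) →
      evalAlgebraicClosure E α
        (MvPolynomial.eval (fun i => y₀ i + const E d * const E (t i)) f) ≠ 0 := by
    classical
    set s := {α ∈ hfin.toFinset | ∃ y, evalAlgebraicClosure E α (MvPolynomial.eval y f) ≠ 0}
    have hd' : algebraMap K (AlgebraicClosure K) (d : K) ≠ 0 := by
      rw [map_ne_zero]
      exact fun h => hd (Subtype.ext h)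
    -- `Φ α` is `f` with coefficients evaluated at `α`, in the translated variables `y₀ + d T`. For
    -- `α` in `s` it is nonzero, and a product of nonzero polynomials cannot vanish on all points
    -- with coordinates in the infinite ring V.
    let Φ : AlgebraicClosure K → MvPolynomial σ (AlgebraicClosure K) := fun α =>
      MvPolynomial.eval₂ (MvPolynomial.C.comp (evalAlgebraicClosure E α)) (fun i =>
        MvPolynomial.C (evalAlgebraicClosure E α (y₀ i)) +
          MvPolynomial.C (algebraMap K _ (d : K)) * MvPolynomial.X i) f
    have hΦ : ∀ α T, MvPolynomial.eval T (Φ α) = MvPolynomial.eval₂ (evalAlgebraicClosure E α)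
        (fun i => evalAlgebraicClosure E α (y₀ i) + algebraMap K _ (d : K) * T i) f := by
      intro α T
      rw [MvPolynomial.eval₂_comp_left]
      congr 1
      · ext; simp
      · funext i
        simp
    have hΦ0 : ∏ α ∈ s, Φ α ≠ 0 := by
      refine Finset.prod_ne_zero_iff.2 fun α hα h0 => ?_
      obtain ⟨y, hy⟩ := (Finset.mem_filter.1 hα).2
      have := hΦ α fun i => (evalAlgebraicClosure E α (y i) - evalAlgebraicClosure E α (y₀ i)) /
        algebraMap K _ (d : K)
      rw [h0, map_zero] at this
      rw [MvPolynomial.map_eval_eq_eval₂] at hy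
      refine hy (Eq.trans ?_ this.symm)
      congr 1
      funext i
      rw [mul_div_cancel₀ _ hd', add_sub_cancel]
    have hV : Function.Injective fun c : v.valuationSubring =>
        algebraMap K (AlgebraicClosure K) (c : K) :=
      (algebraMap K (AlgebraicClosure K)).injective.comp Subtype.val_injective
    have := infinite_valuationSubring v
    obtain ⟨T, hT, hT0⟩ : ∃ T ∈ Set.pi Set.univ fun _ : σ =>
        Set.range fun c : v.valuationSubring => algebraMap K (AlgebraicClosure K) (c : K),
        MvPolynomial.eval T (∏ α ∈ s, Φ α) ≠ 0 := by
      by_contra! hcon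
      exact hΦ0 (MvPolynomial.funext_set _ (fun _ => Set.infinite_range_of_injective hV)
        fun T hT => by rw [hcon T hT, map_zero])
    choose t ht using fun i => hT i trivial
    refine ⟨t, fun α hα hy => ?_⟩
    rw [map_prod, Finset.prod_ne_zero_iff] at hT0
    have := hT0 α (Finset.mem_filter.2 ⟨hfin.mem_toFinset.2 hα, hy⟩)
    rw [hΦ] at this
    rw [MvPolynomial.map_eval_eq_eval₂]
    convert this using 3
    rename_i i
    rw [map_add, map_mul, evalAlgebraicClosure_const, evalAlgebraicClosure_const, ← ht i]
  refine ⟨fun i => y₀ i + const E d * const E (t i), ?_⟩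
  set F := MvPolynomial.eval (fun i => y₀ i + const E d * const E (t i)) f with hF
  have hFJ : F ∈ Ideal.span {F} ⊔ I :=
    Ideal.mem_sup_left (Ideal.mem_span_singleton_self _)
  have hFres : ∀ a : E, residueAt a F = residueAt a (MvPolynomial.eval y₀ f) := by
    intro a
    rw [hF, MvPolynomial.map_eval_eq_eval₂, MvPolynomial.map_eval_eq_eval₂]
    congr 1
    funext i
    simp [residueAt_const, hdres]
  refine ideal_eq_top_of_no_zero hE hg (Ideal.mem_sup_right hgI) ![F, h] ?_ ?_ ?_
  · intro i
    fin_cases i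
    · exact hFJ
    · exact Ideal.mem_sup_right hh
  · intro a
    by_cases hha : residueAt a h = 0
    · refine ⟨0, ?_⟩
      change residueAt a F ≠ 0
      rw [hFres]
      refine hy₀ a ?_
      have := congrArg (residueAt a) hch
      rw [map_add, hha, add_zero, map_one] at this
      rw [this]
      exact one_ne_zero
    · exact ⟨1, hha⟩
  · intro α
    -- A common root `α` is a root of `g` and `F`; by the choice of `t` all values of `f` vanish at
    -- `α`, hence so does `c`, and `c + h = 1` fails there.
    by_contra! hall
    refine ht α (hall g (Ideal.mem_sup_right hgI)) ?_ (hall F hFJ)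
    by_contra! hzero
    have hc0 : evalAlgebraicClosure E α c = 0 := by
      have : Ideal.span (Set.range fun y => MvPolynomial.eval y f) ≤
          RingHom.ker (evalAlgebraicClosure E α) :=
        Ideal.span_le.2 (Set.range_subset_iff.2 hzero)
      exact this hc
    have := congrArg (evalAlgebraicClosure E α) hch
    rw [map_add, hc0, hall h (Ideal.mem_sup_right hh), map_one, add_zero] at this
    exact zero_ne_one this

end integerValuedPolynomials

/-- A ring is local-global if every polynomial whose values generate the unit ideal takes a unit
value. -/
theorem IsLocalGlobal.of_span_eval {R : Type*} [CommRing R]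
    (H : ∀ (n : ℕ) (f : MvPolynomial (Fin n) R),
      Ideal.span (Set.range fun y => MvPolynomial.eval y f) = ⊤ →
        ∃ y, IsUnit (MvPolynomial.eval y f)) : IsLocalGlobal R := by
  intro n f hf
  refine H n f ?_
  by_contra hne
  obtain ⟨M, hM, hle⟩ := Ideal.exists_le_maximal _ hne
  obtain ⟨x, hx⟩ := hf M
  -- The residue field at `M` is already a quotient of `R`, so the local point can be replaced by a
  -- global one modulo `M`.
  have hsurj : Function.Surjective
      ((IsLocalRing.residue (Localization.AtPrime M)).comp (algebraMap R _)) :=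
    M.algebraMap_residueField_surjective
  choose y hy using fun i => hsurj (IsLocalRing.residue _ (x i))
  have h1 : (IsLocalRing.residue (Localization.AtPrime M)).comp (algebraMap R _)
      (MvPolynomial.eval y f) = IsLocalRing.residue _ (MvPolynomial.aeval x f) := by
    rw [MvPolynomial.map_eval_eq_eval₂, MvPolynomial.aeval_def, MvPolynomial.eval₂_comp_left]
    congr 1
    exact funext hy
  have h2 : MvPolynomial.eval y f ∈ M := hle (Ideal.subset_span ⟨y, rfl⟩)
  have h3 : IsLocalRing.residue (Localization.AtPrime M)
      (algebraMap R _ (MvPolynomial.eval y f)) = 0 := by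
    rw [IsLocalRing.residue_eq_zero_iff]
    exact (IsLocalization.AtPrime.to_map_mem_maximal_iff _ M _).2 h2
  rw [← RingHom.comp_apply, h1] at h3
  exact (hx.map (IsLocalRing.residue _)).ne_zero h3

/-- The ring of integer-valued polynomials is almost local-global if every infinite subset of `E`
contains a pseudo-convergent sequence. -/
theorem integerValuedPolynomials.isAlmostLocalGlobal [v.RankOne]
    (hE : HasPseudoConvergentSubsequences v ((↑) '' E)) :
    IsAlmostLocalGlobal (integerValuedPolynomials K E) := by
  intro I hI
  refine IsLocalGlobal.of_span_eval fun n f hf => ?_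
  obtain ⟨f, rfl⟩ := MvPolynomial.map_surjective _ (Ideal.Quotient.mk_surjective (I := I)) f
  have hev : ∀ y, MvPolynomial.eval (fun i => Ideal.Quotient.mk I (y i))
      (MvPolynomial.map (Ideal.Quotient.mk I) f) =
        Ideal.Quotient.mk I (MvPolynomial.eval y f) := fun y => by
    rw [MvPolynomial.eval_map, MvPolynomial.map_eval_eq_eval₂]
  have hspan : Ideal.span (Set.range fun y => MvPolynomial.eval y f) ⊔ I = ⊤ := by
    rw [← Ideal.mk_ker (I := I), ← Ideal.comap_map_of_surjective' _ Ideal.Quotient.mk_surjective,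
      Ideal.map_span, eq_top_iff, ← Ideal.comap_top (f := Ideal.Quotient.mk I), ← hf]
    refine Ideal.comap_mono (Ideal.span_mono ?_)
    rintro _ ⟨y, rfl⟩
    choose z hz using fun i => Ideal.Quotient.mk_surjective (y i)
    refine ⟨_, ⟨z, rfl⟩, ?_⟩
    rw [← hev]
    simp only [hz]
  obtain ⟨y, hy⟩ := exists_span_eval_sup_eq_top hE hI f hspan
  refine ⟨fun i => Ideal.Quotient.mk I (y i), ?_⟩
  rw [hev, ← Ideal.span_singleton_eq_top, ← Set.image_singleton, ← Ideal.map_span]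
  have := congrArg (Ideal.map (Ideal.Quotient.mk I)) hy
  rwa [Ideal.map_sup, Ideal.map_quotient_self, sup_bot_eq, Ideal.map_top] at this

end LocalGlobal

/-! ### Rank-one summands and unimodular vectors. -/

section RankOneSummands

theorem mem_submoduleContent {R : Type*} [CommRing R] {m : ℕ} {N : Submodule R (Fin m → R)}
    {x : Fin m → R} (hx : x ∈ N) (l : (Fin m → R) →ₗ[R] R) : l x ∈ submoduleContent N := by
  rw [LinearMap.pi_apply_eq_sum_univ l x]
  exact Ideal.sum_mem _ fun i _ => Ideal.mul_mem_right _ _ (Ideal.subset_span ⟨x, hx, i, rfl⟩)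

variable {R : Type*} [CommRing R] {m : ℕ} {N : Submodule R (Fin m → R)}

/-- If the minors of order two of `N` vanish, multiplication by an element of the content of `N`
extends to a linear map with values in `N`. -/
theorem exists_linearMap_eq_smul_of_mem_content
    (hmin : ∀ x ∈ N, ∀ y ∈ N, ∀ i j, x i * y j = x j * y i) {c : R}
    (hc : c ∈ submoduleContent N) :
    ∃ l : (Fin m → R) →ₗ[R] N, ∀ y : N, l y = c • y := by
  induction hc using Submodule.span_induction with
  | mem c h =>
    obtain ⟨x, hx, i, rfl⟩ := h
    -- Vanishing minors say that `y i • x = x i • y` for `y` in `N`.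
    refine ⟨(LinearMap.proj i).smulRight ⟨x, hx⟩, fun y => Subtype.ext (funext fun j => ?_)⟩
    have := hmin x hx y y.2 i j
    simp only [LinearMap.smulRight_apply, LinearMap.proj_apply, Submodule.coe_smul, Pi.smul_apply,
      smul_eq_mul]
    rw [this, mul_comm]
  | zero => exact ⟨0, fun y => by simp⟩
  | add c d _ _ hc hd =>
    obtain ⟨l, hl⟩ := hc
    obtain ⟨l', hl'⟩ := hd
    exact ⟨l + l', fun y => by rw [LinearMap.add_apply, hl, hl', add_smul]⟩
  | smul r c _ hc =>
    obtain ⟨l, hl⟩ := hc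
    exact ⟨r • l, fun y => by rw [LinearMap.smul_apply, hl, smul_eq_mul, mul_smul]⟩

/-- A submodule of `R ^ m` with unit content whose minors of order two vanish is a rank-one
projective summand. -/
theorem rankOne_summand_of_minors_eq_zero [IsDomain R] (hN : submoduleContent N = ⊤)
    (hmin : ∀ x ∈ N, ∀ y ∈ N, ∀ i j, x i * y j = x j * y i) :
    Module.Projective R N ∧ (∀ p : PrimeSpectrum R, Module.rankAtStalk N p = 1) ∧
      ∃ Q : Submodule R (Fin m → R), IsCompl N Q := by
  -- For the content element 1 the map is a retraction onto `N`.
  obtain ⟨l, hl⟩ := exists_linearMap_eq_smul_of_mem_content hmin (c := 1) (by rw [hN]; trivial)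
  have hl1 : ∀ y : N, l y = y := fun y => by rw [hl, one_smul]
  have hproj : Module.Projective R N :=
    Module.Projective.of_split N.subtype l (LinearMap.ext hl1)
  have hfin : Module.Finite R N := Module.Finite.of_surjective l fun y => ⟨y, hl1 y⟩
  refine ⟨hproj, fun p => ?_, _, LinearMap.isCompl_of_proj hl1⟩
  rw [Module.rankAtStalk_eq, Ideal.finrank_fiber_eq_finrank]
  have hnt : Nontrivial N := by
    by_contra hsub
    rw [not_nontrivial_iff_subsingleton, Submodule.subsingleton_iff_eq_bot] at hsub
    have : submoduleContent N ≤ ⊥ := by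
      refine Ideal.span_le.2 ?_
      rintro _ ⟨x, hx, i, rfl⟩
      rw [hsub, Submodule.mem_bot] at hx
      simp [hx]
    rw [hN] at this
    exact top_ne_bot (le_bot_iff.1 this)
  have hle : Module.rank R N ≤ (1 : ℕ) := by
    refine rank_le fun s hs => ?_
    by_contra! hcard
    obtain ⟨x, hx, y, hy, hxy⟩ := Finset.one_lt_card.1 hcard
    have hx0 : x ≠ 0 := hs.ne_zero ⟨x, hx⟩
    obtain ⟨i, hi⟩ : ∃ i, (x : Fin m → R) i ≠ 0 := by
      by_contra! h0
      exact hx0 (Subtype.ext (funext h0))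
    have hpair : LinearIndependent R ![x, y] := by
      have := hs.comp ![⟨x, hx⟩, ⟨y, hy⟩] (by
        intro i j hij
        fin_cases i <;> fin_cases j <;> simp_all)
      convert this using 1
      funext i
      fin_cases i <;> rfl
    rw [LinearIndependent.pair_iff] at hpair
    have := hpair (-(y : Fin m → R) i) ((x : Fin m → R) i) (Subtype.ext (funext fun j => by
      have := hmin x x.2 y y.2 i j
      simp only [Submodule.coe_add, Submodule.coe_smul, Pi.add_apply, Pi.smul_apply, smul_eq_mul,
        this, Submodule.coe_zero, Pi.zero_apply]
      ring))
    exact hi this.2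
  refine le_antisymm (Module.finrank_le_of_rank_le hle) ?_
  rw [Nat.one_le_iff_ne_zero, ← Nat.pos_iff_ne_zero, Module.finrank_pos_iff]
  exact hnt

/-- Over a principal ideal domain, a submodule with unit content contains a unimodular vector. -/
theorem exists_linearMap_eq_one_of_content_eq_top {A : Type*} [CommRing A] [IsDomain A]
    [IsPrincipalIdealRing A] {m : ℕ} (N : Submodule A (Fin m → A))
    (hN : submoduleContent N = ⊤) : ∃ e ∈ N, ∃ l : (Fin m → A) →ₗ[A] A, l e = 1 := by
  obtain ⟨n, snf⟩ := N.smithNormalForm (Pi.basisFun A (Fin m))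
  have hle : submoduleContent N ≤ Ideal.span (Set.range snf.a) := by
    refine Ideal.span_le.2 ?_
    rintro _ ⟨x, hx, i, rfl⟩
    have := congrArg (fun z : N => (z : Fin m → A) i) (snf.bN.sum_repr ⟨x, hx⟩)
    simp only at this
    rw [← this, Submodule.coe_sum, Finset.sum_apply]
    refine Ideal.sum_mem _ fun j _ => ?_
    rw [Submodule.coe_smul, snf.snf, Pi.smul_apply, Pi.smul_apply, smul_eq_mul, smul_eq_mul]
    exact Ideal.mul_mem_left _ _ (Ideal.mul_mem_right _ _ (Ideal.subset_span ⟨j, rfl⟩))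
  have h1 : (1 : A) ∈ Ideal.span (Set.range snf.a) := hle (by rw [hN]; trivial)
  obtain ⟨c, hc⟩ := (Submodule.mem_span_range_iff_exists_fun A).1 h1
  -- In the adapted basis this vector has the elementary divisors `snf.a` as coordinates, and they
  -- generate the unit ideal.
  refine ⟨∑ j, (snf.bN j : Fin m → A), Submodule.sum_mem _ fun j _ => (snf.bN j).2,
    ∑ j, c j • snf.bM.coord (snf.f j), ?_⟩
  rw [← hc]
  simp [LinearMap.sum_apply, snf.snf, Finsupp.single_apply, snf.f.injective.eq_iff, mul_comm]

end RankOneSummands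

/-! ### The unit content summand property. -/

section UnitContentSummand

variable {K Γ₀ : Type*} [Field K] [LinearOrderedCommGroupWithZero Γ₀] {v : Valuation K Γ₀}
  {E : Set v.valuationSubring}

theorem finite_setOf_add_mul_eq_zero {A D : Type*} [CommRing A] [CommRing D] [IsDomain D]
    {φ : A →+* D} (hφ : Function.Injective φ) (a : D) {b : D} (hb : b ≠ 0) :
    {s | a + b * φ s = 0}.Finite := by
  refine Set.Subsingleton.finite fun s hs t ht => hφ (mul_left_cancel₀ hb ?_)
  exact add_left_cancel (Eq.trans hs (Eq.symm ht))

namespace integerValuedPolynomials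

theorem evalAlgebraicClosure_comp_const_injective (α : AlgebraicClosure K) :
    Function.Injective ((evalAlgebraicClosure E α).comp (const E)) := fun c d h => by
  rw [RingHom.comp_apply, RingHom.comp_apply, evalAlgebraicClosure_const,
    evalAlgebraicClosure_const] at h
  exact Subtype.ext ((algebraMap K _).injective h)

theorem exists_const_forall_mul_mem (E : Set v.valuationSubring) {ι : Type*} [Fintype ι]
    (F : ι → K[X]) : ∃ c : v.valuationSubring, c ≠ 0 ∧
      ∀ i, Polynomial.C (c : K) * F i ∈ integerValuedPolynomials K E := by
  classical
  choose c hc hcF using fun i => exists_const_mul_mem E (F i)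
  refine ⟨∏ i, c i, Finset.prod_ne_zero_iff.2 fun i _ => hc i, fun i => ?_⟩
  rw [← Finset.mul_prod_erase _ _ (Finset.mem_univ i), mul_comm (c i), MulMemClass.coe_mul,
    Polynomial.C_mul, mul_assoc]
  exact mul_mem (const E _).2 (hcF i)

variable {m : ℕ} {N : Submodule (integerValuedPolynomials K E)
  (Fin m → integerValuedPolynomials K E)}

/-- Glueing of vectors of `N` modulo the maximal ideal. -/
theorem exists_mem_residueAt_ne_zero (hE : HasPseudoConvergentSubsequences v ((↑) '' E))
    {c : integerValuedPolynomials K E} (hc : c ∈ submoduleContent N) :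
    ∃ w ∈ N, ∀ a : E, residueAt a c ≠ 0 → ∃ i, residueAt a (w i) ≠ 0 := by
  induction hc using Submodule.span_induction with
  | mem c h =>
    obtain ⟨x, hx, i, rfl⟩ := h
    exact ⟨x, hx, fun a ha => ⟨i, ha⟩⟩
  | zero => exact ⟨0, zero_mem _, fun a h => (h (map_zero _)).elim⟩
  | add c d _ _ hc hd =>
    obtain ⟨x, hxN, hx⟩ := hc
    obtain ⟨y, hyN, hy⟩ := hd
    obtain ⟨e, -, he⟩ := exists_indicator hE x
    refine ⟨e • x + (1 - e) • y, add_mem (N.smul_mem _ hxN) (N.smul_mem _ hyN), fun a ha => ?_⟩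
    by_cases hxa : ∃ i, residueAt a (x i) ≠ 0
    · have he1 := (he a).2 hxa
      obtain ⟨i, hi⟩ := hxa
      exact ⟨i, by simpa [he1] using hi⟩
    · have hc0 : residueAt a c = 0 := by
        by_contra hc0
        exact hxa (hx a hc0)
      push Not at hxa
      have he0 := (he a).1 hxa
      rw [map_add, hc0, zero_add] at ha
      obtain ⟨i, hi⟩ := hy a ha
      exact ⟨i, by simpa [he0] using hi⟩
  | smul r c _ hc =>
    obtain ⟨w, hwN, hw⟩ := hc
    refine ⟨w, hwN, fun a ha => hw a fun h0 => ha ?_⟩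
    rw [smul_eq_mul, map_mul, h0, mul_zero]

/-- Over the principal ideal domain K[X] the span of `N` contains a unimodular vector; clearing
denominators of the vector and of the linear form turns 1 into a nonzero constant. -/
theorem exists_linearMap_eq_const (hN : submoduleContent N = ⊤) :
    ∃ e ∈ N, ∃ l : (Fin m → integerValuedPolynomials K E) →ₗ[integerValuedPolynomials K E]
      integerValuedPolynomials K E, ∃ c : v.valuationSubring, c ≠ 0 ∧ l e = const E c := by
  set N' : Submodule K[X] (Fin m → K[X]) :=
    Submodule.span K[X] ((fun (x : Fin m → integerValuedPolynomials K E) i =>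
      (x i : K[X])) '' N)
  have hcont : submoduleContent N' = ⊤ := by
    have hle : submoduleContent N ≤
        (submoduleContent N').comap (integerValuedPolynomials K E).subtype := by
      refine Ideal.span_le.2 ?_
      rintro _ ⟨x, hx, i, rfl⟩
      exact Ideal.subset_span ⟨_, Submodule.subset_span ⟨x, hx, rfl⟩, i, rfl⟩
    rw [hN] at hle
    exact Ideal.comap_eq_top_iff.1 (top_le_iff.1 hle)
  obtain ⟨e, he, l, hl⟩ := exists_linearMap_eq_one_of_content_eq_top N' hcont
  obtain ⟨c, hc, x, hxN, hx⟩ : ∃ c : v.valuationSubring, c ≠ 0 ∧ ∃ x ∈ N,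
      ∀ i, (x i : K[X]) = Polynomial.C (c : K) * e i := by
    clear hl
    induction he using Submodule.span_induction with
    | mem e h =>
      obtain ⟨x, hx, rfl⟩ := h
      exact ⟨1, one_ne_zero, x, hx, fun i => by simp⟩
    | zero => exact ⟨1, one_ne_zero, 0, zero_mem _, fun i => by simp⟩
    | add e f _ _ he hf =>
      obtain ⟨c, hc, x, hx, hxe⟩ := he
      obtain ⟨d, hd, y, hy, hyf⟩ := hf
      refine ⟨c * d, mul_ne_zero hc hd, const E d • x + const E c • y,
        add_mem (N.smul_mem _ hx) (N.smul_mem _ hy), fun i => ?_⟩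
      rw [Pi.add_apply, Pi.smul_apply, Pi.smul_apply, smul_eq_mul, smul_eq_mul, Subring.coe_add,
        Subring.coe_mul, Subring.coe_mul, hxe, hyf, coe_const, coe_const, MulMemClass.coe_mul,
        Polynomial.C_mul, Pi.add_apply]
      ring
    | smul p e _ he =>
      obtain ⟨c, hc, x, hx, hxe⟩ := he
      obtain ⟨d, hd, hdp⟩ := exists_const_mul_mem E p
      refine ⟨d * c, mul_ne_zero hd hc, (⟨_, hdp⟩ : integerValuedPolynomials K E) • x,
        N.smul_mem _ hx, fun i => ?_⟩
      rw [Pi.smul_apply, smul_eq_mul, Subring.coe_mul, hxe, MulMemClass.coe_mul, Polynomial.C_mul,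
        Pi.smul_apply, smul_eq_mul]
      ring
  obtain ⟨d, hd, hdl⟩ := exists_const_forall_mul_mem E fun i => l (Pi.single i 1)
  refine ⟨x, hxN, ∑ i, (⟨_, hdl i⟩ : integerValuedPolynomials K E) • LinearMap.proj i, d * c,
    mul_ne_zero hd hc, Subtype.ext ?_⟩
  have hsingle : ∀ i, (fun j => if i = j then 1 else 0) = (Pi.single i 1 : Fin m → K[X]) :=
    fun i => by
      funext j
      simp [Pi.single_apply, eq_comm]
  rw [LinearMap.pi_apply_eq_sum_univ l e] at hl
  simp only [hsingle] at hl
  have hrhs : (const E (d * c) : K[X]) =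
      ∑ i, Polynomial.C (d : K) * l (Pi.single i 1) * (Polynomial.C (c : K) * e i) := by
    rw [coe_const, MulMemClass.coe_mul, Polynomial.C_mul]
    refine (mul_one _).symm.trans ?_
    conv_lhs => rw [← hl]
    rw [Finset.mul_sum]
    refine Finset.sum_congr rfl fun i _ => ?_
    rw [smul_eq_mul]
    ring
  rw [hrhs]
  simp only [LinearMap.sum_apply, LinearMap.smul_apply, LinearMap.proj_apply, smul_eq_mul,
    AddSubmonoidClass.coe_finsetSum, Subring.coe_mul, hx]

/-- If some minor of order two of `N` does not vanish, a submodule with unit content contains a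
unimodular vector. -/
theorem exists_mem_content_span_eq_top [v.RankOne]
    (hE : HasPseudoConvergentSubsequences v ((↑) '' E)) (hN : submoduleContent N = ⊤)
    (hmin : ∃ x ∈ N, ∃ y ∈ N, ∃ i j, x i * y j ≠ x j * y i) :
    ∃ w ∈ N, submoduleContent (Submodule.span (integerValuedPolynomials K E) {w}) = ⊤ := by
  obtain ⟨w, hwN, hw⟩ := exists_mem_residueAt_ne_zero hE (N := N) (c := 1) (by rw [hN]; trivial)
  obtain ⟨e, heN, l, c, hc, hlc⟩ := exists_linearMap_eq_const hN
  obtain ⟨d, hd, hdres⟩ := exists_const_residue_eq_zero v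
  have := infinite_valuationSubring v
  have hconst : ∀ {b : v.valuationSubring}, b ≠ 0 → const E b ≠ 0 := fun hb =>
    (map_ne_zero_iff _ const_injective).2 hb
  -- If `l` were injective on `N`, every `c x` would equal `l x` times `e`, and all minors would
  -- vanish.
  obtain ⟨f, hfN, hlf, hf⟩ : ∃ f ∈ N, l f = 0 ∧ f ≠ 0 := by
    by_contra! hcon
    have hprop : ∀ x ∈ N, ∀ i, const E c * x i = l x * e i := by
      intro x hx i
      have := hcon (const E c • x - l x • e) (sub_mem (N.smul_mem _ hx) (N.smul_mem _ heN)) (by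
        rw [map_sub, map_smul, map_smul, hlc, smul_eq_mul, smul_eq_mul, mul_comm, sub_self])
      exact sub_eq_zero.1 (congrFun this i)
    obtain ⟨x, hx, y, hy, i, j, hne⟩ := hmin
    refine hne (mul_left_cancel₀ (mul_ne_zero (hconst hc) (hconst hc)) ?_)
    calc const E c * const E c * (x i * y j) = (const E c * x i) * (const E c * y j) := by ring
      _ = (const E c * x j) * (const E c * y i) := by
        rw [hprop x hx, hprop y hy, hprop x hx, hprop y hy]; ring
      _ = const E c * const E c * (x j * y i) := by ring
  obtain ⟨i, hi⟩ := Function.ne_iff.1 hf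
  set g := const E c * f i
  have hg : g ≠ 0 := mul_ne_zero (hconst hc) hi
  -- `μ` kills `e` and sends `f` to `g`, while `l` kills `f` and sends `e` to `c`: the two forms can
  -- be adjusted independently.
  set μ := const E c • LinearMap.proj (R := integerValuedPolynomials K E)
    (φ := fun _ : Fin m => integerValuedPolynomials K E) i - e i • l with hμ
  have hμe : μ e = 0 := by
    simp only [hμ, LinearMap.sub_apply, LinearMap.smul_apply, LinearMap.proj_apply, smul_eq_mul,
      hlc]
    ring
  have hμf : μ f = g := by
    simp only [hμ, LinearMap.sub_apply, LinearMap.smul_apply, LinearMap.proj_apply, smul_eq_mul,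
      hlf, mul_zero, sub_zero, g]
  have hne : ∀ {b : v.valuationSubring} (α : AlgebraicClosure K), b ≠ 0 →
      evalAlgebraicClosure E α (const E b) ≠ 0 := fun α hb =>
    (map_ne_zero_iff _ (evalAlgebraicClosure_comp_const_injective (E := E) α)).2 hb
  -- Each root of `g` forbids at most one `s`; the remaining choices make `G` nonzero and without
  -- common root with `g`.
  obtain ⟨s, hs⟩ := ((((finite_roots hg).biUnion fun α _ =>
    finite_setOf_add_mul_eq_zero (evalAlgebraicClosure_comp_const_injective (E := E) α)
      (evalAlgebraicClosure E α (l w)) (hne α (mul_ne_zero hd hc)))).union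
    (finite_setOf_add_mul_eq_zero (const_injective (K := K) (E := E)) (l w)
      (hconst (mul_ne_zero hd hc)))).infinite_compl.nonempty
  set G := l w + const E (d * c) * const E s with hG
  have hG0 : G ≠ 0 := fun h => hs (Or.inr h)
  have hGg : ∀ α, evalAlgebraicClosure E α G = 0 → evalAlgebraicClosure E α g ≠ 0 := by
    intro α hα hgα
    refine hs (Or.inl (Set.mem_biUnion hgα ?_))
    rw [hG, map_add, map_mul] at hα
    exact hα
  -- At a root of `G` the coefficient `d g` of `t` is nonzero, so at most one `t` is bad there.
  obtain ⟨t, ht⟩ := ((finite_roots hG0).biUnion fun α hα =>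
    finite_setOf_add_mul_eq_zero (evalAlgebraicClosure_comp_const_injective (E := E) α)
      (evalAlgebraicClosure E α (μ w))
      (mul_ne_zero (hne α hd) (hGg α hα))).infinite_compl.nonempty
  -- Since `d` has residue zero, `w'` has the residues of `w` on `E`, while `l w' = G` and `μ w'`
  -- have no common root.
  set w' := w + const E d • (const E s • e + const E t • f) with hw'
  have hw'N : w' ∈ N := add_mem hwN
    (N.smul_mem _ (add_mem (N.smul_mem _ heN) (N.smul_mem _ hfN)))
  have hlw' : l w' = G := by
    simp only [hw', hG, map_add, map_smul, smul_eq_mul, hlc, hlf, map_mul]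
    ring
  have hμw' : μ w' = μ w + const E d * g * const E t := by
    simp only [hw', map_add, map_smul, smul_eq_mul, hμe, hμf]
    ring
  refine ⟨w', hw'N, ?_⟩
  have hmem := mem_submoduleContent (Submodule.mem_span_singleton_self (R :=
    integerValuedPolynomials K E) w')
  refine ideal_eq_top_of_no_zero hE hG0 (hlw' ▸ hmem l) w' (fun j => hmem (LinearMap.proj j))
    (fun a => ?_) fun α => ?_
  · obtain ⟨j, hj⟩ := hw a (by rw [map_one]; exact one_ne_zero)
    refine ⟨j, ?_⟩
    simpa [hw', residueAt_const, hdres] using hj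
  · by_contra! hall
    have h1 := hall _ (hmem l)
    have h2 := hall _ (hmem μ)
    rw [hlw'] at h1
    refine ht (Set.mem_biUnion h1 ?_)
    rw [hμw', map_add, map_mul, map_mul] at h2
    exact h2

/-- The ring of integer-valued polynomials has the unit content summand property if every infinite
subset of `E` contains a pseudo-convergent sequence. -/
theorem hasUCSProperty [v.RankOne] (hE : HasPseudoConvergentSubsequences v ((↑) '' E)) :
    HasUCSProperty (integerValuedPolynomials K E) := by
  intro m N _ hN
  by_cases hmin : ∀ x ∈ N, ∀ y ∈ N, ∀ i j, x i * y j = x j * y i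
  · exact ⟨N, le_rfl, rankOne_summand_of_minors_eq_zero hN hmin⟩
  · push Not at hmin
    obtain ⟨w, hwN, hw⟩ := exists_mem_content_span_eq_top hE hN hmin
    refine ⟨_, (Submodule.span_singleton_le_iff_mem _ _).2 hwN,
      rankOne_summand_of_minors_eq_zero hw ?_⟩
    intro x hx y hy i j
    obtain ⟨r, rfl⟩ := Submodule.mem_span_singleton.1 hx
    obtain ⟨r', rfl⟩ := Submodule.mem_span_singleton.1 hy
    simp only [Pi.smul_apply, smul_eq_mul]
    ring

end integerValuedPolynomials

end UnitContentSummand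

theorem mainTheorem2 {K Γ₀ : Type*} [Field K] [LinearOrderedCommGroupWithZero Γ₀]
    (v : Valuation K Γ₀) [v.RankOne] (E : Set v.valuationSubring)
    (hdiv : ¬ ∃ x : ℕ → v.valuationSubring,
      (∀ n, x n ∈ E) ∧ IsPseudoDivergent v (fun n => (x n : K)))
    (hstat : ¬ ∃ x : ℕ → v.valuationSubring,
      (∀ n, x n ∈ E) ∧ IsPseudoStationary v (fun n => (x n : K))) :
    HasUCSProperty (integerValuedPolynomials K E) ∧
      IsAlmostLocalGlobal (integerValuedPolynomials K E) := by
  have hE : HasPseudoConvergentSubsequences v ((↑) '' E) := by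
    intro T hT hinf
    have hlift : ∀ x : ℕ → K, (∀ n, x n ∈ T) →
        ∃ y : ℕ → v.valuationSubring, (∀ n, y n ∈ E) ∧ (fun n => (y n : K)) = x := by
      intro x hx
      choose y hyE hy using fun n => hT (hx n)
      exact ⟨y, hyE, funext hy⟩
    refine exists_isPseudoConvergent v T (fun x hx h => ?_) (fun x hx h => ?_) hinf
    · obtain ⟨y, hyE, rfl⟩ := hlift x hx
      exact hdiv ⟨y, hyE, h⟩
    · obtain ⟨y, hyE, rfl⟩ := hlift x hx
      exact hstat ⟨y, hyE, h⟩
  exact ⟨integerValuedPolynomials.hasUCSProperty hE,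
    integerValuedPolynomials.isAlmostLocalGlobal hE⟩
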